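/- Let $q$ be an indeterminate. Write $(a;q)_k=(1-a)(1-aq)\cdots(1-aq^{k-1})$ (with $(a;q)_0=1$), $[m]=1+q+\cdots+q^{m-1}$, and let $\Phi_n(q)$ be the $n$-th cyclotomic polynomial. For rational functions $A(q),B(q)\in\mathbb{Q}(q)$ and a polynomial $P(q)\in\mathbb{Q}[q]$, write $A(q)\equiv B(q)\pmod{P(q)}$ if $P(q)$ divides, in $\mathbb{Q}[q]$, the numerator of $A(q)-B(q)$ written in lowest terms. Then, for every positive odd integer $n$ and for both $M=(n-1)/2$ and $M=n-1$, $$\sum_{k=0}^{M}[4k+1]\frac{(q;q^2)_k^4}{(q^2;q^2)_k^4}\equiv q^{(1-n)/2}[n]+\frac{(n^2-1)(1-q)^2}{24}\,q^{(1-n)/2}[n]^3 \pmod{[n]\Phi_n(q)^3}.$$ -/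

import Mathlib

open Polynomial

/-- The `q`-shifted factorial `(a;q)_k = (1 - a)(1 - a q) ⋯ (1 - a q^(k-1))`. -/
def qShiftedFactorial {R : Type*} [CommRing R] (a q : R) (k : ℕ) : R :=
  ∏ i ∈ Finset.range k, (1 - a * q ^ i)

/-- The `q`-integer `[n] = 1 + q + ⋯ + q^(n-1)`. -/
def qInteger {R : Type*} [CommRing R] (q : R) (n : ℕ) : R :=
  ∑ i ∈ Finset.range n, q ^ i

/-- Congruence of rational functions modulo a polynomial `P`: in lowest terms, the numerator of
`A - B` is divisible by `P` (so that the denominator of `A - B` is coprime to `P`). -/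
def RatFuncCongr (P : ℚ[X]) (A B : RatFunc ℚ) : Prop :=
  P ∣ (A - B).num

/-- The truncated sum `∑_{k=0}^{M} [4k+1] (q;q²)_k⁴ / (q²;q²)_k⁴` in `ℚ(q)`. -/
noncomputable def truncatedSum (M : ℕ) : RatFunc ℚ :=
  let q : RatFunc ℚ := RatFunc.X
  ∑ k ∈ Finset.range (M + 1),
    qInteger q (4 * k + 1) * qShiftedFactorial q (q ^ 2) k ^ 4
      / qShiftedFactorial (q ^ 2) (q ^ 2) k ^ 4

/-- The rational function `q^((1-n)/2) [n] + (n² - 1)(1 - q)² / 24 * q^((1-n)/2) [n]³`, for odd `n`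
(so that the integer division by `2` in the exponent is exact). -/
noncomputable def congruenceRHS (n : ℕ) : RatFunc ℚ :=
  let q : RatFunc ℚ := RatFunc.X
  q ^ ((1 - (n : ℤ)) / 2) * qInteger q n
    + ((n : RatFunc ℚ) ^ 2 - 1) * (1 - q) ^ 2 / 24 * q ^ ((1 - (n : ℤ)) / 2) * qInteger q n ^ 3

/-!
Put `y = q^n`. Rogers' terminating `₆φ₅` sum in base `q²` with first parameter `q` has three further
parameters, one of which is the terminating `q^(1-n) = q y⁻¹`. Taking for them `q` times the roots
of `Z³ - 3Z² + eZ - 1`, with `e` such that `y⁻¹` is one of the roots, makes the summand a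
perturbation of `(1 - q^(4k+1)) (q;q²)_k⁴ / (q²;q²)_k⁴` by the single parameter `w = -(1-y)³ / y²`,
which is divisible by `Φ_n³`.

At a primitive `n`-th root of unity, the reflection `k ↦ (n-1)/2 - k` changes the sign of the
summand and preserves its logarithmic derivative in `w`. The first-order term in `w` therefore
vanishes modulo `Φ_n`, and Rogers' sum computes the truncated sum modulo `Φ_n⁴`. On the product
side, `(1 - y) q^((1-n)/2)` is multiplied by factors `1 - (1-y)² P / (y (y - (3 - y⁻¹) P + P²))`
with `P = q^(2i)`, and the cubic term comes from `∑ P / (1-P)² = -(n²-1)/24` at the root of unity.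

The terms with `k > (n-1)/2` are divisible by `Φ_n⁴`. For a divisor `d ≠ 1` of `n`, cut the sum into
blocks of `d` consecutive terms: modulo `Φ_d`, the first `(d+1)/2` terms of a block cancel by the
same reflection, and the others vanish.
-/

open Finset

section VeryWellPoised

variable {K : Type*} [Field K]

/-- The `k`-th coefficient of Rogers' very-well-poised series `₆φ₅` in base `q` with parameters
`a, b, c, y⁻¹` and argument `a * q * y / (b * c)`. The parameters `b` and `c` enter only through
`s = b + c` and `p = b * c`, and each step is cleared of the denominators `b`, `c` and `y`. -/
def veryWellPoisedCoeff (a q s p y : K) (k : ℕ) : K :=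
  ∏ i ∈ range k, a * q * ((1 - a * q ^ i) * (1 - s * q ^ i + p * (q ^ i) ^ 2)) /
    ((1 - q ^ (i + 1)) * (p - s * a * q ^ (i + 1) + (a * q ^ (i + 1)) ^ 2)) *
      ((y - q ^ i) / (1 - a * y * q ^ (i + 1)))

variable {a q s p y : K}

theorem veryWellPoisedCoeff_succ (k : ℕ) :
    veryWellPoisedCoeff a q s p y (k + 1) = veryWellPoisedCoeff a q s p y k *
      (a * q * ((1 - a * q ^ k) * (1 - s * q ^ k + p * (q ^ k) ^ 2)) /
        ((1 - q ^ (k + 1)) * (p - s * a * q ^ (k + 1) + (a * q ^ (k + 1)) ^ 2)) *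
          ((y - q ^ k) / (1 - a * y * q ^ (k + 1)))) :=
  prod_range_succ _ _

theorem veryWellPoisedCoeff_pow_eq_zero {N k : ℕ} (h : N < k) :
    veryWellPoisedCoeff a q s p (q ^ N) k = 0 :=
  prod_eq_zero (mem_range.2 h) (by simp)

theorem veryWellPoisedCoeff_contiguous (hy : ∀ i : ℕ, 1 - a * y * q ^ (i + 1) ≠ 0) (k : ℕ) :
    veryWellPoisedCoeff a q s p y k * (q ^ k * (q * y - 1) * (1 - a * y * q)) =
      veryWellPoisedCoeff a q s p (q * y) k * ((q * y - q ^ k) * (1 - a * y * q ^ (k + 1))) := by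
  induction k with
  | zero => simp [veryWellPoisedCoeff]
  | succ k ih =>
    have h1 := hy k
    have h2 := hy (k + 1)
    have e : a * (q * y) * q ^ (k + 1) = a * y * q ^ (k + 1 + 1) := by ring
    rw [veryWellPoisedCoeff_succ, veryWellPoisedCoeff_succ, e]
    generalize a * q * _ / _ = c
    generalize veryWellPoisedCoeff a q s p (q * y) k = F at ih ⊢
    generalize 1 - a * y * q ^ (k + 1) = d₁ at ih h1 ⊢
    generalize 1 - a * y * q ^ (k + 1 + 1) = d₂ at h2 ⊢
    field_simp
    linear_combination c * q * (y - q ^ k) * ih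

/-- The polynomial identity behind the telescoping of the contiguous combination: it equates its
`k`-th term with a difference, where `z` stands for `q ^ k`. -/
theorem veryWellPoised_certificate {R : Type*} [CommRing R] (a q s p y z : R) :
    (1 - a * z ^ 2) * ((p - s * a * (q * y) + (a * (q * y)) ^ 2) * (z * (q * y - 1)) -
        (p - a * (q * y)) * ((q * y - z) * (1 - a * y * (q * z)))) =
      q * y * (a * (1 - a * z) * (1 - s * z + p * z ^ 2) * (q * y - z) -
        (1 - z) * (p - s * a * z + (a * z) ^ 2) * (1 - a * y * (q * z))) := by
  ring

theorem veryWellPoised_contiguous_term (hq0 : q ≠ 0) (hqy : q * y - 1 ≠ 0)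
    (hy : ∀ i : ℕ, 1 - a * y * q ^ (i + 1) ≠ 0) (k : ℕ) :
    (1 - a * (q ^ k) ^ 2) *
        ((p - s * a * (q * y) + (a * (q * y)) ^ 2) * veryWellPoisedCoeff a q s p (q * y) k -
          (1 - a * (q * y)) * (p - a * (q * y)) * veryWellPoisedCoeff a q s p y k) =
      q * y / (q * y - 1) * (veryWellPoisedCoeff a q s p (q * y) k / q ^ k) *
        (a * (1 - a * q ^ k) * (1 - s * q ^ k + p * (q ^ k) ^ 2) * (q * y - q ^ k) -
          (1 - q ^ k) * (p - s * a * q ^ k + (a * q ^ k) ^ 2) * (1 - a * y * q ^ (k + 1))) := by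
  have hz : q ^ k ≠ 0 := pow_ne_zero _ hq0
  have contiguous := veryWellPoisedCoeff_contiguous (s := s) (p := p) hy k
  have certificate := veryWellPoised_certificate a q s p y (q ^ k)
  rw [pow_succ'] at contiguous ⊢
  field_simp
  linear_combination veryWellPoisedCoeff a q s p (q * y) k * certificate -
    (1 - a * (q ^ k) ^ 2) * (p - a * (q * y)) * contiguous

theorem sum_veryWellPoised_contiguous (hq0 : q ≠ 0) (hq : ∀ i : ℕ, 1 - q ^ (i + 1) ≠ 0)
    (hqy : q * y - 1 ≠ 0) (hy : ∀ i : ℕ, 1 - a * y * q ^ (i + 1) ≠ 0) (m : ℕ)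
    (hβ : ∀ i < m, p - s * a * q ^ (i + 1) + (a * q ^ (i + 1)) ^ 2 ≠ 0) :
    ∑ k ∈ range (m + 1), (1 - a * (q ^ k) ^ 2) *
        ((p - s * a * (q * y) + (a * (q * y)) ^ 2) * veryWellPoisedCoeff a q s p (q * y) k -
          (1 - a * (q * y)) * (p - a * (q * y)) * veryWellPoisedCoeff a q s p y k) =
      q * y / (q * y - 1) * (veryWellPoisedCoeff a q s p (q * y) m / q ^ m) *
        (a * (1 - a * q ^ m) * (1 - s * q ^ m + p * (q ^ m) ^ 2) * (q * y - q ^ m)) := by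
  induction m with
  | zero =>
    rw [zero_add, sum_range_one, veryWellPoised_contiguous_term hq0 hqy hy, pow_zero, sub_self]
    ring
  | succ m ih =>
    rw [sum_range_succ, ih fun i hi => hβ i (by omega),
      veryWellPoised_contiguous_term hq0 hqy hy (m + 1)]
    have telescope : veryWellPoisedCoeff a q s p (q * y) m / q ^ m *
          (a * (1 - a * q ^ m) * (1 - s * q ^ m + p * (q ^ m) ^ 2) * (q * y - q ^ m)) =
        veryWellPoisedCoeff a q s p (q * y) (m + 1) / q ^ (m + 1) * ((1 - q ^ (m + 1)) *
          (p - s * a * q ^ (m + 1) + (a * q ^ (m + 1)) ^ 2) * (1 - a * y * q ^ (m + 1 + 1))) := by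
      have hd := div_mul_cancel₀ (a * q * ((1 - a * q ^ m) * (1 - s * q ^ m + p * (q ^ m) ^ 2)))
        (mul_ne_zero (hq m) (hβ m m.lt_succ_self))
      have hy := hy (m + 1)
      rw [veryWellPoisedCoeff_succ,
        show a * (q * y) * q ^ (m + 1) = a * y * q ^ (m + 1 + 1) by ring]
      generalize a * q * _ / _ = c at hd ⊢
      generalize (1 - q ^ (m + 1)) * _ = d at hd ⊢
      generalize 1 - a * y * q ^ (m + 1 + 1) = e at hy ⊢
      rw [pow_succ' q m]
      field_simp
      linear_combination -(veryWellPoisedCoeff a q s p (q * y) m * (q * y - q ^ m)) * hd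
    linear_combination q * y / (q * y - 1) * telescope

/-- Rogers' terminating `₆φ₅` summation. -/
theorem sum_veryWellPoised (hq0 : q ≠ 0) (hq : ∀ i : ℕ, 1 - q ^ (i + 1) ≠ 0)
    (ha : ∀ i : ℕ, 1 - a * q ^ (i + 1) ≠ 0) (N : ℕ)
    (hβ : ∀ i < N, p - s * a * q ^ (i + 1) + (a * q ^ (i + 1)) ^ 2 ≠ 0) :
    ∑ k ∈ range (N + 1), (1 - a * (q ^ k) ^ 2) * veryWellPoisedCoeff a q s p (q ^ N) k =
      (1 - a) * ∏ i ∈ range N, (1 - a * q ^ (i + 1)) * (p - a * q ^ (i + 1)) /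
        (p - s * a * q ^ (i + 1) + (a * q ^ (i + 1)) ^ 2) := by
  induction N with
  | zero => simp [veryWellPoisedCoeff]
  | succ N ih =>
    have contiguous := sum_veryWellPoised_contiguous (a := a) (s := s) (p := p) (y := q ^ N) hq0 hq
      (by rw [← pow_succ', ← neg_ne_zero, neg_sub]; exact hq N)
      (fun i => by rw [mul_assoc, ← pow_add]; exact ha (N + i)) (N + 1) hβ
    simp only [← pow_succ', sub_self, mul_zero, mul_sub, sum_sub_distrib] at contiguous
    rw [sum_range_succ (fun k => _ * (_ * veryWellPoisedCoeff a q s p (q ^ N) k)),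
      veryWellPoisedCoeff_pow_eq_zero N.lt_succ_self, mul_zero, mul_zero, add_zero,
      sub_eq_zero] at contiguous
    rw [prod_range_succ, ← mul_assoc, ← ih fun i hi => hβ i (by omega), mul_div_assoc',
      eq_div_iff (hβ N N.lt_succ_self), sum_mul, sum_mul]
    convert contiguous using 2 <;> ring

end VeryWellPoised

section Perturbation

variable {K : Type*} [Field K] {q : K}

/-- The product `(q;q²)_k⁴ / (q²;q²)_k⁴` perturbed by a parameter `w`, which replaces three of the
four factors `1 - q ^ (2 * i + 1)`, and three of the four factors `1 - q ^ (2 * i + 2)`. -/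
def perturbedRatio (q w : K) (k : ℕ) : K :=
  ∏ i ∈ range k, (1 - q ^ (2 * i + 1)) *
      ((1 - q ^ (2 * i + 1)) ^ 3 + w * (q ^ (2 * i + 1)) ^ 2) /
    ((1 - q ^ (2 * i + 2)) * ((1 - q ^ (2 * i + 2)) ^ 3 - w * q ^ (2 * i + 2)))

/-- The three parameters are `q` times the roots of `Z ^ 3 - 3 * Z ^ 2 + e * Z - 1`, where `e` is
chosen so that one of the roots is `y⁻¹`. -/
theorem veryWellPoisedCoeff_eq_perturbedRatio (hq : q ≠ 0) {y : K} (hy : y ≠ 0) (k : ℕ) :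
    veryWellPoisedCoeff q (q ^ 2) (q * (3 - y⁻¹)) (q ^ 2 * y) (y / q) k =
      perturbedRatio q (-(1 - y) ^ 3 / y ^ 2) k := by
  refine prod_congr rfl fun i _ => ?_
  have hQ : (q ^ 2) ^ i = q ^ (2 * i + 1) / q := by
    rw [eq_div_iff hq, ← pow_mul, pow_succ]
  have hP : (q ^ 2) ^ (i + 1) = q ^ (2 * i + 2) := by rw [← pow_mul, mul_add]
  rw [hQ, hP]
  generalize q ^ (2 * i + 1) = Q
  generalize q ^ (2 * i + 2) = P
  rw [div_mul_div_comm, ← mul_div_mul_left ((1 - Q) * _) _ (mul_ne_zero (pow_ne_zero 2 hq) hy)]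
  congr 1 <;> field_simp <;> ring

theorem prod_range_even_pow {M : Type*} [CommMonoid M] (q : M) (N : ℕ) :
    ∏ i ∈ range N, q ^ (2 * i + 2) = q ^ (N * (N + 1)) := by
  rw [prod_pow_eq_pow_sum, sum_add_distrib, ← mul_sum, mul_comm 2, sum_range_id_mul_two, sum_const,
    card_range, smul_eq_mul]
  congr 1
  cases N <;> simp; ring

theorem one_sub_mul_prod_one_sub_odd_pow {R : Type*} [CommRing R] (q : R) (N : ℕ) :
    (1 - q) * ∏ i ∈ range N, (1 - q ^ (2 * i + 3)) =
      (1 - q ^ (2 * N + 1)) * ∏ i ∈ range N, (1 - q ^ (2 * i + 1)) := by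
  rw [mul_comm (1 - q ^ _), ← prod_range_succ (fun i => 1 - q ^ (2 * i + 1)), prod_range_succ',
    mul_zero, zero_add, pow_one, mul_comm]
  rfl

theorem prod_odd_factors_eq_prod_even_factors (hq : q ≠ 0) (N : ℕ) :
    ∏ i ∈ range N, (1 - q ^ (2 * i + 1)) * (q ^ (2 * N + 1) - q ^ (2 * i + 1)) =
      (q ^ N)⁻¹ * ∏ i ∈ range N, (1 - q ^ (2 * i + 2)) * (q ^ (2 * N + 1) - q ^ (2 * i + 2)) := by
  have prod_ratio : ∏ i ∈ range N, q ^ (2 * N + 1) / (q ^ (2 * i + 2)) ^ 2 = (q ^ N)⁻¹ := by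
    rw [prod_div_distrib, prod_pow _ 2, prod_range_even_pow, prod_const, card_range, ← pow_mul,
      ← pow_mul, div_eq_iff (pow_ne_zero _ hq), eq_inv_mul_iff_mul_eq₀ (pow_ne_zero _ hq),
      ← pow_add]
    ring
  rw [← prod_range_reflect, ← prod_ratio, ← prod_mul_distrib]
  refine prod_congr rfl fun i hi => ?_
  have hi := mem_range.1 hi
  have reflect : q ^ (2 * (N - 1 - i) + 1) = q ^ (2 * N + 1) / q ^ (2 * i + 2) := by
    rw [eq_div_iff (pow_ne_zero _ hq), ← pow_add]
    congr 1
    omega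
  have hP : q ^ (2 * i + 2) ≠ 0 := pow_ne_zero _ hq
  rw [reflect]
  field_simp
  ring

theorem sum_perturbedRatio_eq_prod (hq0 : q ≠ 0) (hq : ∀ m : ℕ, 0 < m → 1 - q ^ m ≠ 0) {N : ℕ}
    {y : K} (hy : y = q ^ (2 * N + 1))
    (hβ : ∀ i < N, y - (3 - y⁻¹) * q ^ (2 * i + 2) + (q ^ (2 * i + 2)) ^ 2 ≠ 0) :
    ∑ k ∈ range (N + 1), (1 - q ^ (4 * k + 1)) * perturbedRatio q (-(1 - y) ^ 3 / y ^ 2) k =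
      (1 - q) * ∏ i ∈ range N, (1 - q ^ (2 * i + 3)) * (y - q ^ (2 * i + 1)) /
        (y - (3 - y⁻¹) * q ^ (2 * i + 2) + (q ^ (2 * i + 2)) ^ 2) := by
  have hq2 : q ^ 2 ≠ 0 := pow_ne_zero 2 hq0
  have pow_even (i : ℕ) : (q ^ 2) ^ (i + 1) = q ^ (2 * i + 2) := by rw [← pow_mul, mul_add]
  have pow_odd (i : ℕ) : q * q ^ (2 * i + 2) = q ^ (2 * i + 3) := (pow_succ' q (2 * i + 2)).symm
  have scale (i : ℕ) : q ^ 2 * y - q * (3 - y⁻¹) * q * q ^ (2 * i + 2) + (q * q ^ (2 * i + 2)) ^ 2 =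
      q ^ 2 * (y - (3 - y⁻¹) * q ^ (2 * i + 2) + (q ^ (2 * i + 2)) ^ 2) := by ring
  have rogers := sum_veryWellPoised (a := q) (q := q ^ 2) (s := q * (3 - y⁻¹)) (p := q ^ 2 * y)
    hq2 (fun i => by rw [pow_even]; exact hq _ (by omega))
    (fun i => by rw [pow_even, pow_odd]; exact hq _ (by omega)) N
    (fun i hi => by rw [pow_even, scale]; exact mul_ne_zero hq2 (hβ i hi))
  have pow_last : (q ^ 2) ^ N = y / q := by rw [hy, eq_div_iff hq0, ← pow_mul, pow_succ]
  have pow_weight (k : ℕ) : q * ((q ^ 2) ^ k) ^ 2 = q ^ (4 * k + 1) := by ring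
  simp only [pow_last, pow_weight, veryWellPoisedCoeff_eq_perturbedRatio hq0
    (hy ▸ pow_ne_zero _ hq0 : y ≠ 0)] at rogers
  rw [rogers]
  congr 1
  refine prod_congr rfl fun i _ => ?_
  rw [pow_even, scale, pow_odd, ← mul_div_mul_left (_ * (y - _)) _ hq2]
  ring

theorem sum_perturbedRatio (hq0 : q ≠ 0) (hq : ∀ m : ℕ, 0 < m → 1 - q ^ m ≠ 0) {N : ℕ} {y : K}
    (hy : y = q ^ (2 * N + 1))
    (hβ : ∀ i < N, y - (3 - y⁻¹) * q ^ (2 * i + 2) + (q ^ (2 * i + 2)) ^ 2 ≠ 0) :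
    ∑ k ∈ range (N + 1), (1 - q ^ (4 * k + 1)) * perturbedRatio q (-(1 - y) ^ 3 / y ^ 2) k =
      (1 - y) * (q ^ N)⁻¹ * ∏ i ∈ range N, (1 + (1 - y) ^ 2 * -(q ^ (2 * i + 2) /
        (y * (y - (3 - y⁻¹) * q ^ (2 * i + 2) + (q ^ (2 * i + 2)) ^ 2)))) := by
  have hy0 : y ≠ 0 := hy ▸ pow_ne_zero _ hq0
  rw [sum_perturbedRatio_eq_prod hq0 hq hy hβ, prod_div_distrib, prod_mul_distrib, mul_div_assoc',
    ← mul_assoc, one_sub_mul_prod_one_sub_odd_pow, mul_assoc, ← prod_mul_distrib, hy,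
    prod_odd_factors_eq_prod_even_factors hq0, ← hy, mul_div_assoc, mul_div_assoc,
    ← prod_div_distrib, ← mul_assoc]
  congr 1
  refine prod_congr rfl fun i hi => ?_
  have hβ := hβ i (mem_range.1 hi)
  generalize q ^ (2 * i + 2) = P at *
  have expand : (1 - P) * (y - P) =
      y - (3 - y⁻¹) * P + P ^ 2 - (1 - y) ^ 2 * P / y := by
    field_simp
    ring
  rw [expand]
  generalize y - (3 - y⁻¹) * P + P ^ 2 = β at *
  field_simp
  ring

end Perturbation

section Specialization

universe u

variable {K L : Type u} [Field K] [Field L] [Algebra K L] {ι : Type*}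

/-- The rational function `f` is regular at `ζ` and takes the value `c` there. Regularity is asked
for separately because `RatFunc.eval` returns `0` at a pole. -/
def SpecializesTo (ζ : L) (f : RatFunc K) (c : L) : Prop :=
  aeval ζ f.denom ≠ 0 ∧ f.eval (algebraMap K L) ζ = c

namespace SpecializesTo

variable {ζ b c : L} {f g : RatFunc K} {s : Finset ι} {F : ι → RatFunc K} {G : ι → L}

theorem of_eq (h : SpecializesTo ζ f c) (hc : c = b) : SpecializesTo ζ f b := hc ▸ h

theorem polynomial (ζ : L) (a : K[X]) :
    SpecializesTo ζ (algebraMap K[X] (RatFunc K) a) (aeval ζ a) :=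
  ⟨by simp, by simp [RatFunc.eval_algebraMap, aeval_def]⟩

theorem X (ζ : L) : SpecializesTo ζ (RatFunc.X : RatFunc K) ζ := by
  simpa using polynomial (K := K) ζ Polynomial.X

theorem one (ζ : L) : SpecializesTo ζ (1 : RatFunc K) 1 := by simpa using polynomial (K := K) ζ 1

theorem zero (ζ : L) : SpecializesTo ζ (0 : RatFunc K) 0 := by simpa using polynomial (K := K) ζ 0

theorem natCast (ζ : L) (n : ℕ) : SpecializesTo ζ (n : RatFunc K) n := by
  simpa using polynomial ζ (n : K[X])

theorem add (hf : SpecializesTo ζ f b) (hg : SpecializesTo ζ g c) :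
    SpecializesTo ζ (f + g) (b + c) :=
  ⟨ne_zero_of_dvd_ne_zero (by simpa using ⟨hf.1, hg.1⟩)
    (map_dvd (aeval ζ) (RatFunc.denom_add_dvd f g)),
    by rw [RatFunc.eval_add (algebraMap K L) ζ hf.1 hg.1, hf.2, hg.2]⟩

theorem mul (hf : SpecializesTo ζ f b) (hg : SpecializesTo ζ g c) :
    SpecializesTo ζ (f * g) (b * c) :=
  ⟨ne_zero_of_dvd_ne_zero (by simpa using ⟨hf.1, hg.1⟩)
    (map_dvd (aeval ζ) (RatFunc.denom_mul_dvd f g)),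
    by rw [RatFunc.eval_mul (algebraMap K L) ζ hf.1 hg.1, hf.2, hg.2]⟩

theorem neg (hf : SpecializesTo ζ f b) : SpecializesTo ζ (-f) (-b) := by
  simpa using (polynomial ζ (-1 : K[X])).mul hf

theorem sub (hf : SpecializesTo ζ f b) (hg : SpecializesTo ζ g c) :
    SpecializesTo ζ (f - g) (b - c) := by
  simpa only [sub_eq_add_neg] using hf.add hg.neg

theorem pow (hf : SpecializesTo ζ f b) (k : ℕ) : SpecializesTo ζ (f ^ k) (b ^ k) := by
  induction k with
  | zero => simpa using one ζ
  | succ k ih => simpa only [pow_succ] using ih.mul hf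

theorem ne_zero (hf : SpecializesTo ζ f b) (hb : b ≠ 0) : f ≠ 0 := by
  rintro rfl
  exact hb (hf.2.symm.trans (RatFunc.eval_zero _ _))

theorem aeval_num (hf : SpecializesTo ζ f b) : aeval ζ f.num = b * aeval ζ f.denom :=
  (div_eq_iff hf.1).1 hf.2

theorem inv (hf : SpecializesTo ζ f b) (hb : b ≠ 0) : SpecializesTo ζ f⁻¹ b⁻¹ := by
  have hf0 := hf.ne_zero hb
  have regular : aeval ζ f⁻¹.denom ≠ 0 :=
    ne_zero_of_dvd_ne_zero (hf.aeval_num ▸ mul_ne_zero hb hf.1)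
      (map_dvd (aeval ζ) (RatFunc.denom_inv_dvd hf0))
  refine ⟨regular, eq_inv_of_mul_eq_one_right ?_⟩
  rw [← hf.2, ← RatFunc.eval_mul (algebraMap K L) ζ hf.1 regular, mul_inv_cancel₀ hf0,
    RatFunc.eval_one]

theorem div (hf : SpecializesTo ζ f b) (hg : SpecializesTo ζ g c) (hc : c ≠ 0) :
    SpecializesTo ζ (f / g) (b / c) := by
  simpa only [div_eq_mul_inv] using hf.mul (hg.inv hc)

theorem sum (h : ∀ i ∈ s, SpecializesTo ζ (F i) (G i)) :
    SpecializesTo ζ (∑ i ∈ s, F i) (∑ i ∈ s, G i) := by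
  induction s using Finset.cons_induction with
  | empty => simpa using zero ζ
  | cons i s hi ih =>
    rw [forall_mem_cons] at h
    simpa only [sum_cons] using h.1.add (ih h.2)

theorem prod (h : ∀ i ∈ s, SpecializesTo ζ (F i) (G i)) :
    SpecializesTo ζ (∏ i ∈ s, F i) (∏ i ∈ s, G i) := by
  induction s using Finset.cons_induction with
  | empty => simpa using one ζ
  | cons i s hi ih =>
    rw [forall_mem_cons] at h
    simpa only [prod_cons] using h.1.mul (ih h.2)

theorem one_sub_X_pow (ζ : L) (m : ℕ) :
    SpecializesTo ζ (1 - RatFunc.X ^ m : RatFunc K) (1 - ζ ^ m) :=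
  (one ζ).sub ((X ζ).pow m)

theorem prod_one_add_mul {w : RatFunc K} (hw : SpecializesTo ζ w 0)
    (h : ∀ i ∈ s, SpecializesTo ζ (F i) (G i)) :
    ∃ g, SpecializesTo ζ g (∑ i ∈ s, G i) ∧ ∏ i ∈ s, (1 + w * F i) = 1 + w * g := by
  induction s using Finset.cons_induction with
  | empty => exact ⟨0, zero ζ, by simp⟩
  | cons i s hi ih =>
    rw [forall_mem_cons] at h
    obtain ⟨g, hg, prod_eq⟩ := ih h.2
    refine ⟨F i + g + w * (F i * g), ?_, by rw [prod_cons, prod_eq]; ring⟩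
    exact ((h.1.add hg).add (hw.mul (h.1.mul hg))).of_eq (by rw [sum_cons]; ring)

end SpecializesTo

theorem one_sub_X_pow_ne_zero {m : ℕ} (hm : 0 < m) : (1 - RatFunc.X ^ m : RatFunc K) ≠ 0 :=
  (SpecializesTo.one_sub_X_pow (0 : K) m).ne_zero (by simp [hm.ne'])

end Specialization

section RootsOfUnity

variable {R k : Type*} [CommRing R] {z : R} [Field k] {ζ : k} {n N : ℕ}

/-- The quotient `(q;q²)_m / (q²;q²)_m`. -/
def qRatio (q : k) (m : ℕ) : k :=
  ∏ i ∈ range m, (1 - q ^ (2 * i + 1)) / (1 - q ^ (2 * i + 2))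

/-- The sum of the coefficients of `w` to first order in the factors of `perturbedRatio ζ w m`,
each taken relative to the factor at `w = 0`. -/
def qLogDeriv (ζ : k) (m : ℕ) : k :=
  ∑ i ∈ range m, ((ζ ^ (2 * i + 1)) ^ 2 / (1 - ζ ^ (2 * i + 1)) ^ 3 +
    ζ ^ (2 * i + 2) / (1 - ζ ^ (2 * i + 2)) ^ 3)

theorem one_sub_pow_ne_zero_of_not_dvd (hz : IsPrimitiveRoot z n) {m : ℕ} (h : ¬n ∣ m) :
    1 - z ^ m ≠ 0 :=
  sub_ne_zero.2 fun h1 => h (hz.dvd_of_pow_eq_one m h1.symm)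

theorem one_sub_odd_pow_ne_zero (hz : IsPrimitiveRoot z (2 * N + 1)) {i : ℕ} (hi : i < N) :
    1 - z ^ (2 * i + 1) ≠ 0 :=
  one_sub_pow_ne_zero_of_not_dvd hz (Nat.not_dvd_of_pos_of_lt (by omega) (by omega))

theorem one_sub_even_pow_ne_zero (hz : IsPrimitiveRoot z (2 * N + 1)) {i : ℕ} (hi : i < 2 * N) :
    1 - z ^ (2 * i + 2) ≠ 0 := by
  rw [show 2 * i + 2 = 2 * (i + 1) by ring]
  exact one_sub_pow_ne_zero_of_not_dvd hz fun h => Nat.not_dvd_of_pos_of_lt (by omega) (by omega)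
    ((Nat.Coprime.dvd_mul_left (by simp)).1 h)

theorem inv_even_pow_eq_odd_pow (hζ : ζ ^ (2 * N + 1) = 1) {i j : ℕ} (h : i + j + 1 = N) :
    (ζ ^ (2 * i + 2))⁻¹ = ζ ^ (2 * j + 1) := by
  refine inv_eq_of_mul_eq_one_right ?_
  rw [← pow_add, show 2 * i + 2 + (2 * j + 1) = 2 * N + 1 by omega, hζ]

@[to_additive]
theorem prod_range_sub_mul_prod_range_reflect {M : Type*} [CommMonoid M] (f : ℕ → M) {m : ℕ}
    (hm : m ≤ N) :
    (∏ i ∈ range (N - m), f i) * ∏ i ∈ range m, f (N - 1 - i) = ∏ i ∈ range N, f i := by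
  induction m with
  | zero => simp
  | succ m ih =>
    rw [← ih (by omega), show N - m = N - (m + 1) + 1 by omega, prod_range_succ _ (N - (m + 1)),
      prod_range_succ _ m, show N - 1 - m = N - (m + 1) by omega, mul_right_comm, mul_assoc]

theorem qRatio_factor_mul_reflect (hζ : IsPrimitiveRoot ζ (2 * N + 1)) {i j : ℕ}
    (h : i + j + 1 = N) :
    (1 - ζ ^ (2 * i + 1)) / (1 - ζ ^ (2 * i + 2)) *
      ((1 - ζ ^ (2 * j + 1)) / (1 - ζ ^ (2 * j + 2))) = ζ⁻¹ := by
  have hζ0 : ζ ≠ 0 := hζ.ne_zero (by omega)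
  have hQ := one_sub_odd_pow_ne_zero hζ (show i < N by omega)
  have hP := one_sub_even_pow_ne_zero hζ (show i < 2 * N by omega)
  have hQ0 : ζ ^ (2 * i + 1) ≠ 0 := pow_ne_zero _ hζ0
  have hP' : 1 - ζ ^ (2 * j + 2) ≠ 0 := one_sub_even_pow_ne_zero hζ (by omega)
  rw [← inv_even_pow_eq_odd_pow hζ.pow_eq_one h]
  rw [← inv_inv (ζ ^ (2 * j + 2)),
    inv_even_pow_eq_odd_pow hζ.pow_eq_one (show j + i + 1 = N by omega)] at hP' ⊢
  rw [show 2 * i + 2 = 2 * i + 1 + 1 by rfl, pow_succ ζ (2 * i + 1)] at hP ⊢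
  generalize ζ ^ (2 * i + 1) = Q at *
  have hinv : 1 - Q⁻¹ = -(1 - Q) / Q := by field_simp; ring
  rw [hinv]
  field_simp
  ring

theorem qRatio_reflect (hζ : IsPrimitiveRoot ζ (2 * N + 1)) {m : ℕ} (hm : m ≤ N) :
    qRatio ζ (N - m) = qRatio ζ N * ζ ^ m * qRatio ζ m := by
  have hζ0 : ζ ≠ 0 := hζ.ne_zero (by omega)
  have reflected : (∏ i ∈ range m,
      (1 - ζ ^ (2 * (N - 1 - i) + 1)) / (1 - ζ ^ (2 * (N - 1 - i) + 2))) * qRatio ζ m =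
        (ζ ^ m)⁻¹ := by
    rw [qRatio, ← prod_mul_distrib, ← inv_pow, ← card_range m, ← prod_const, card_range]
    refine prod_congr rfl fun i hi => qRatio_factor_mul_reflect hζ ?_
    have := mem_range.1 hi
    omega
  have split := prod_range_sub_mul_prod_range_reflect
    (fun i => (1 - ζ ^ (2 * i + 1)) / (1 - ζ ^ (2 * i + 2))) hm
  rw [qRatio, qRatio, ← split, mul_right_comm, mul_assoc (∏ i ∈ range (N - m), _), reflected,
    inv_mul_cancel_right₀ (pow_ne_zero m hζ0)]

theorem qRatio_top_pow_four (hζ : IsPrimitiveRoot ζ (2 * N + 1)) : qRatio ζ N ^ 4 = ζ := by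
  have sq_mul : qRatio ζ N ^ 2 * ζ ^ N = 1 := by
    have := qRatio_reflect hζ le_rfl
    rw [Nat.sub_self, qRatio, prod_range_zero] at this
    rw [this]
    ring
  have pow_eq_one := hζ.pow_eq_one
  linear_combination ζ * (qRatio ζ N ^ 2 * ζ ^ N + 1) * sq_mul - qRatio ζ N ^ 4 * pow_eq_one

theorem qRatio_pow_four_reflect (hζ : IsPrimitiveRoot ζ (2 * N + 1)) {m : ℕ} (hm : m ≤ N) :
    qRatio ζ (N - m) ^ 4 = ζ ^ (4 * m + 1) * qRatio ζ m ^ 4 := by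
  rw [qRatio_reflect hζ hm, mul_pow, mul_pow, qRatio_top_pow_four hζ]
  ring

theorem div_one_sub_cube_inv {P : k} (hP : P ≠ 0) (h : 1 - P ≠ 0) :
    P⁻¹ ^ 2 / (1 - P⁻¹) ^ 3 = -(P / (1 - P) ^ 3) := by
  have hinv : 1 - P⁻¹ = -(1 - P) / P := by field_simp; ring
  rw [hinv, div_pow, Odd.neg_pow (by decide)]
  field_simp

theorem odd_pow_sq_div_one_sub_cube (hζ : IsPrimitiveRoot ζ (2 * N + 1)) {i j : ℕ}
    (h : i + j + 1 = N) :
    (ζ ^ (2 * j + 1)) ^ 2 / (1 - ζ ^ (2 * j + 1)) ^ 3 =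
      -(ζ ^ (2 * i + 2) / (1 - ζ ^ (2 * i + 2)) ^ 3) := by
  rw [← inv_even_pow_eq_odd_pow hζ.pow_eq_one h]
  exact div_one_sub_cube_inv (pow_ne_zero _ (hζ.ne_zero (by omega)))
    (one_sub_even_pow_ne_zero hζ (by omega))

theorem qLogDeriv_reflect (hζ : IsPrimitiveRoot ζ (2 * N + 1)) {m : ℕ} (hm : m ≤ N) :
    qLogDeriv ζ (N - m) = qLogDeriv ζ N + qLogDeriv ζ m := by
  have reflected : ∑ i ∈ range m, ((ζ ^ (2 * (N - 1 - i) + 1)) ^ 2 /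
      (1 - ζ ^ (2 * (N - 1 - i) + 1)) ^ 3 +
        ζ ^ (2 * (N - 1 - i) + 2) / (1 - ζ ^ (2 * (N - 1 - i) + 2)) ^ 3) + qLogDeriv ζ m = 0 := by
    rw [qLogDeriv, ← sum_add_distrib]
    refine sum_eq_zero fun i hi => ?_
    have hi := mem_range.1 hi
    rw [odd_pow_sq_div_one_sub_cube hζ (show i + (N - 1 - i) + 1 = N by omega),
      odd_pow_sq_div_one_sub_cube hζ (show N - 1 - i + i + 1 = N by omega)]
    ring
  have split := sum_range_sub_add_sum_range_reflect
    (fun i => (ζ ^ (2 * i + 1)) ^ 2 / (1 - ζ ^ (2 * i + 1)) ^ 3 +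
      ζ ^ (2 * i + 2) / (1 - ζ ^ (2 * i + 2)) ^ 3) hm
  rw [qLogDeriv, qLogDeriv, ← split, add_assoc, reflected, add_zero]

theorem sum_range_eq_zero_of_antisymm {M : Type*} [AddCommGroup M] [IsAddTorsionFree M]
    {F : ℕ → M} (h : ∀ m ≤ N, F (N - m) = -F m) : ∑ m ∈ range (N + 1), F m = 0 := by
  have reflect : ∑ m ∈ range (N + 1), F m = ∑ m ∈ range (N + 1), -F m := by
    rw [← sum_range_reflect]
    refine sum_congr rfl fun m hm => ?_
    rw [Nat.add_sub_cancel, h m (mem_range_succ_iff.1 hm)]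
  rw [sum_neg_distrib] at reflect
  exact self_eq_neg.1 reflect

theorem one_sub_pow_mul_qRatio_reflect (hζ : IsPrimitiveRoot ζ (2 * N + 1)) {m : ℕ} (hm : m ≤ N) :
    (1 - ζ ^ (4 * (N - m) + 1)) * qRatio ζ (N - m) ^ 4 =
      -((1 - ζ ^ (4 * m + 1)) * qRatio ζ m ^ 4) := by
  have inverse : ζ ^ (4 * (N - m) + 1) * ζ ^ (4 * m + 1) = 1 := by
    rw [← pow_add, show 4 * (N - m) + 1 + (4 * m + 1) = (2 * N + 1) * 2 by omega, pow_mul,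
      hζ.pow_eq_one, one_pow]
  rw [qRatio_pow_four_reflect hζ hm]
  linear_combination -(qRatio ζ m ^ 4) * inverse

theorem sum_qRatio_eq_zero [CharZero k] (hζ : IsPrimitiveRoot ζ (2 * N + 1)) :
    ∑ m ∈ range (N + 1), (1 - ζ ^ (4 * m + 1)) * qRatio ζ m ^ 4 = 0 :=
  sum_range_eq_zero_of_antisymm fun _ hm => one_sub_pow_mul_qRatio_reflect hζ hm

theorem sum_qRatio_qLogDeriv_eq_zero [CharZero k] (hζ : IsPrimitiveRoot ζ (2 * N + 1)) :
    ∑ m ∈ range (N + 1), (1 - ζ ^ (4 * m + 1)) * qRatio ζ m ^ 4 * qLogDeriv ζ m = 0 := by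
  have top_eq_zero : qLogDeriv ζ N = 0 := by
    have := qLogDeriv_reflect hζ le_rfl
    rw [Nat.sub_self, qLogDeriv, sum_range_zero] at this
    exact self_eq_neg.1 (eq_neg_of_add_eq_zero_left this.symm)
  refine sum_range_eq_zero_of_antisymm fun m hm => ?_
  rw [one_sub_pow_mul_qRatio_reflect hζ hm, qLogDeriv_reflect hζ hm, top_eq_zero, zero_add, neg_mul]

/-- On the `n`-th roots of unity other than `1`, this writes `z / (1 - z) ^ 2` as a polynomial in
`z`, which can be summed over all of them. -/
theorem sum_mul_pow_of_pow_eq_one {z : k} (hz : z ^ n = 1) (hz1 : 1 - z ≠ 0) :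
    (1 - z) ^ 2 * ∑ m ∈ range n, (m : k) * (n - m) * z ^ m = 2 * n * z := by
  have partial_sum (M : ℕ) : (1 - z) ^ 3 * ∑ m ∈ range M, (m : k) * (n - m) * z ^ m =
      (n - 1 : k) * z - (n + 1) * z ^ 2 - z ^ M * (M * (n - M) * (1 - z) ^ 2 +
        (n - 2 * M - 1) * z * (1 - z) - 2 * z ^ 2) := by
    induction M with
    | zero => simp; ring
    | succ M ih => rw [sum_range_succ, mul_add, ih]; push_cast; ring
  have total := partial_sum n
  rw [hz] at total
  apply mul_left_cancel₀ hz1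
  linear_combination total

theorem sum_range_mul_sub [CharZero k] (n : ℕ) :
    ∑ m ∈ range n, (m : k) * (n - m) = n * ((n : k) ^ 2 - 1) / 6 := by
  have partial_sum (c : k) (M : ℕ) : ∑ m ∈ range M, (m : k) * (c - m) =
      M * (M - 1) * (3 * c - 2 * M + 1) / 6 := by
    induction M with
    | zero => simp
    | succ M ih => rw [sum_range_succ, ih]; push_cast; ring
  rw [partial_sum]
  ring

theorem sum_primitiveRoot_pow_pow_succ (hζ : IsPrimitiveRoot ζ n) {m : ℕ} (hm0 : 0 < m)
    (hm : m < n) : ∑ i ∈ range (n - 1), (ζ ^ (i + 1)) ^ m = -1 := by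
  have geom : ∑ i ∈ range n, (ζ ^ m) ^ i = 0 := by
    apply mul_left_cancel₀
      (one_sub_pow_ne_zero_of_not_dvd hζ (Nat.not_dvd_of_pos_of_lt hm0 hm))
    rw [mul_neg_geom_sum, pow_right_comm, hζ.pow_eq_one, one_pow, sub_self, mul_zero]
  rw [← Nat.sub_add_cancel (hm0.trans hm), sum_range_succ', pow_zero] at geom
  rw [← eq_neg_of_add_eq_zero_left geom]
  simp only [pow_right_comm ζ m]

theorem sum_div_one_sub_sq [CharZero k] (hn : 0 < n) (hζ : IsPrimitiveRoot ζ n) :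
    ∑ i ∈ range (n - 1), ζ ^ (i + 1) / (1 - ζ ^ (i + 1)) ^ 2 = -((n : k) ^ 2 - 1) / 12 := by
  have hn0 : (n : k) ≠ 0 := Nat.cast_ne_zero.2 hn.ne'
  have finite_fourier : ∀ i ∈ range (n - 1), ζ ^ (i + 1) / (1 - ζ ^ (i + 1)) ^ 2 =
      (∑ m ∈ range n, (m : k) * (n - m) * (ζ ^ (i + 1)) ^ m) / (2 * n) := fun i hi => by
    have hi := mem_range.1 hi
    have hne : 1 - ζ ^ (i + 1) ≠ 0 :=
      one_sub_pow_ne_zero_of_not_dvd hζ (Nat.not_dvd_of_pos_of_lt (by omega) (by omega))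
    rw [div_eq_div_iff (pow_ne_zero _ hne) (mul_ne_zero two_ne_zero hn0), mul_comm _ (_ ^ 2),
      sum_mul_pow_of_pow_eq_one (by rw [pow_right_comm, hζ.pow_eq_one, one_pow]) hne, mul_comm]
  have sum_root : ∀ m ∈ range n,
      ∑ i ∈ range (n - 1), (m : k) * (n - m) * (ζ ^ (i + 1)) ^ m = -((m : k) * (n - m)) := by
    intro m hm
    rcases m.eq_zero_or_pos with rfl | hm0
    · simp
    · rw [← mul_sum, sum_primitiveRoot_pow_pow_succ hζ hm0 (mem_range.1 hm), mul_neg_one]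
  rw [sum_congr rfl finite_fourier, ← sum_div, sum_comm, sum_congr rfl sum_root, sum_neg_distrib,
    sum_range_mul_sub]
  field_simp
  ring

theorem div_one_sub_sq_inv {P : k} (hP : P ≠ 0) : P⁻¹ / (1 - P⁻¹) ^ 2 = P / (1 - P) ^ 2 := by
  have hinv : 1 - P⁻¹ = -(1 - P) / P := by field_simp; ring
  rw [hinv, div_pow, neg_sq]
  field_simp

theorem sum_even_div_one_sub_sq [CharZero k] (hζ : IsPrimitiveRoot ζ (2 * N + 1)) :
    ∑ i ∈ range N, ζ ^ (2 * i + 2) / (1 - ζ ^ (2 * i + 2)) ^ 2 =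
      -(((2 * N + 1 : ℕ) : k) ^ 2 - 1) / 24 := by
  have upper_half : ∑ i ∈ range N, ζ ^ (2 * (N + i) + 2) / (1 - ζ ^ (2 * (N + i) + 2)) ^ 2 =
      ∑ i ∈ range N, ζ ^ (2 * i + 2) / (1 - ζ ^ (2 * i + 2)) ^ 2 := by
    rw [← sum_range_reflect]
    refine sum_congr rfl fun i hi => ?_
    have hi := mem_range.1 hi
    have inverse : ζ ^ (2 * (N + (N - 1 - i)) + 2) = (ζ ^ (2 * i + 2))⁻¹ := by
      apply eq_inv_of_mul_eq_one_left
      rw [← pow_add,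
        show 2 * (N + (N - 1 - i)) + 2 + (2 * i + 2) = (2 * N + 1) * 2 by omega, pow_mul,
        hζ.pow_eq_one, one_pow]
    rw [inverse, div_one_sub_sq_inv (pow_ne_zero _ (hζ.ne_zero (by omega)))]
  have total := sum_div_one_sub_sq (by omega) (hζ.pow_of_coprime 2 (by simp))
  simp only [← pow_mul, mul_add, mul_one] at total
  rw [show 2 * N + 1 - 1 = N + N by omega, sum_range_add, upper_half] at total
  linear_combination total / 2

end RootsOfUnity

section Congruence

variable {L : Type} [Field L] [CharZero L] {ζ c : L} {n : ℕ}

theorem cyclotomic_dvd_iff_aeval_eq_zero (hn : 0 < n) (hζ : IsPrimitiveRoot ζ n) {p : ℚ[X]} :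
    cyclotomic n ℚ ∣ p ↔ aeval ζ p = 0 := by
  rw [cyclotomic_eq_minpoly_rat hζ hn, minpoly.dvd_iff]

theorem mul_dvd_num_mul {K : Type*} [Field K] {P Q : K[X]} {f g : RatFunc K} (hP : P ∣ f.num)
    (hQ : Q ∣ g.num) (h : IsCoprime (P * Q) (f.denom * g.denom)) : P * Q ∣ (f * g).num := by
  refine h.dvd_of_dvd_mul_right ?_
  rw [RatFunc.num_denom_mul]
  exact (mul_dvd_mul hP hQ).mul_right _

namespace SpecializesTo

variable {f g : RatFunc ℚ}

theorem isCoprime_denom (hn : 0 < n) (hζ : IsPrimitiveRoot ζ n) (hf : SpecializesTo ζ f c) :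
    IsCoprime (cyclotomic n ℚ) f.denom :=
  ((cyclotomic.irreducible_rat hn).coprime_iff_not_dvd).2
    fun h => hf.1 ((cyclotomic_dvd_iff_aeval_eq_zero hn hζ).1 h)

theorem cyclotomic_dvd_num (hn : 0 < n) (hζ : IsPrimitiveRoot ζ n) (hf : SpecializesTo ζ f 0) :
    cyclotomic n ℚ ∣ f.num :=
  (cyclotomic_dvd_iff_aeval_eq_zero hn hζ).2 (by rw [hf.aeval_num, zero_mul])

theorem cyclotomic_pow_dvd_num (hn : 0 < n) (hζ : IsPrimitiveRoot ζ n) (hf : SpecializesTo ζ f 0)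
    (hg : SpecializesTo ζ g 0) (m : ℕ) : cyclotomic n ℚ ^ (m + 1) ∣ (f ^ m * g).num := by
  induction m with
  | zero => simpa using hg.cyclotomic_dvd_num hn hζ
  | succ m ih =>
    rw [pow_succ' _ (m + 1), pow_succ' f, mul_assoc]
    refine mul_dvd_num_mul (hf.cyclotomic_dvd_num hn hζ) ih ?_
    rw [← pow_succ']
    exact ((hf.isCoprime_denom hn hζ).mul_right
      (((hf.pow m).mul hg).isCoprime_denom hn hζ)).pow_left

end SpecializesTo

namespace RatFuncCongr

variable {A B C f g : RatFunc ℚ} {P : ℚ[X]}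

theorem trans (hAB : RatFuncCongr P A B) (hBC : RatFuncCongr P B C) : RatFuncCongr P A C := by
  have coprime_denom {f : RatFunc ℚ} (hf : P ∣ f.num) : IsCoprime P f.denom :=
    (RatFunc.isCoprime_num_denom f).of_isCoprime_of_dvd_left hf
  rw [RatFuncCongr, ← sub_add_sub_cancel A B C]
  refine ((coprime_denom hAB).mul_right (coprime_denom hBC)).dvd_of_dvd_mul_right ?_
  rw [RatFunc.num_denom_add]
  exact (dvd_add (hAB.mul_right _) (hBC.mul_left _)).mul_right _

theorem of_sub_eq_pow_mul (hn : 0 < n) (hζ : IsPrimitiveRoot ζ n) (hf : SpecializesTo ζ f 0)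
    (hg : SpecializesTo ζ g 0) {m : ℕ} (h : A - B = f ^ m * g) :
    RatFuncCongr (cyclotomic n ℚ ^ (m + 1)) A B := by
  rw [RatFuncCongr, h]
  exact hf.cyclotomic_pow_dvd_num hn hζ hg m

theorem of_mul_left (hn : 0 < n) (hζ : IsPrimitiveRoot ζ n) (hf : SpecializesTo ζ f c)
    (hc : c ≠ 0) {m : ℕ} (h : RatFuncCongr (cyclotomic n ℚ ^ m) (f * A) (f * B)) :
    RatFuncCongr (cyclotomic n ℚ ^ m) A B := by
  rw [RatFuncCongr, ← inv_mul_cancel_left₀ (hf.ne_zero hc) (A - B), mul_sub,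
    ← one_mul (cyclotomic n ℚ ^ m)]
  refine mul_dvd_num_mul (one_dvd _) h ?_
  rw [one_mul]
  exact ((hf.inv hc).isCoprime_denom hn hζ).pow_left.mul_right
    ((RatFunc.isCoprime_num_denom _).of_isCoprime_of_dvd_left h)

end RatFuncCongr

end Congruence

section BasicIdentities

theorem one_sub_mul_qInteger {R : Type*} [CommRing R] (q : R) (m : ℕ) :
    (1 - q) * qInteger q m = 1 - q ^ m :=
  mul_neg_geom_sum q m

theorem qShiftedFactorial_div {K : Type*} [Field K] (q : K) (k : ℕ) :
    qShiftedFactorial q (q ^ 2) k / qShiftedFactorial (q ^ 2) (q ^ 2) k = qRatio q k := by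
  rw [qShiftedFactorial, qShiftedFactorial, qRatio, ← prod_div_distrib]
  refine prod_congr rfl fun i _ => ?_
  congr 2 <;> ring

theorem one_sub_X_mul_truncatedSum (M : ℕ) : (1 - RatFunc.X) * truncatedSum M =
    ∑ k ∈ range (M + 1), (1 - RatFunc.X ^ (4 * k + 1)) * qRatio RatFunc.X k ^ 4 := by
  rw [truncatedSum, mul_sum]
  refine sum_congr rfl fun k _ => ?_
  rw [mul_div_assoc, ← div_pow, qShiftedFactorial_div, ← mul_assoc, one_sub_mul_qInteger]

theorem one_sub_X_mul_congruenceRHS (N : ℕ) : (1 - RatFunc.X) * congruenceRHS (2 * N + 1) =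
    (RatFunc.X ^ N)⁻¹ * ((1 - RatFunc.X ^ (2 * N + 1)) +
      (((2 * N + 1 : ℕ) : RatFunc ℚ) ^ 2 - 1) / 24 * (1 - RatFunc.X ^ (2 * N + 1)) ^ 3) := by
  have half : (1 - ((2 * N + 1 : ℕ) : ℤ)) / 2 = -(N : ℤ) := by omega
  simp only [congruenceRHS]
  rw [half, zpow_neg, zpow_natCast, ← one_sub_mul_qInteger]
  ring

end BasicIdentities

section HighestCyclotomicFactor

theorem perturbed_factor_eq {K : Type*} [Field K] {P Q w : K} (hP : 1 - P ≠ 0) (hQ : 1 - Q ≠ 0)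
    (hw : 1 - w * (P / (1 - P) ^ 3) ≠ 0) :
    (1 - Q) * ((1 - Q) ^ 3 + w * Q ^ 2) / ((1 - P) * ((1 - P) ^ 3 - w * P)) =
      ((1 - Q) / (1 - P)) ^ 4 * (1 + w * ((Q ^ 2 / (1 - Q) ^ 3 + P / (1 - P) ^ 3) /
        (1 - w * (P / (1 - P) ^ 3)))) := by
  have scale : (1 - P) ^ 3 - w * P = (1 - P) ^ 3 * (1 - w * (P / (1 - P) ^ 3)) := by field_simp
  have expand : w * P = (1 - (1 - w * (P / (1 - P) ^ 3))) * (1 - P) ^ 3 := by field_simp; ring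
  rw [scale]
  generalize 1 - w * (P / (1 - P) ^ 3) = t at *
  generalize 1 - Q = Q' at *
  generalize 1 - P = P' at *
  field_simp
  linear_combination -Q' ^ 3 * expand

variable {L : Type} [Field L] [CharZero L] {ζ c : L} {N : ℕ}

theorem SpecializesTo.qRatio {m : ℕ} (h : ∀ i < m, 1 - ζ ^ (2 * i + 2) ≠ 0) :
    SpecializesTo ζ (qRatio (RatFunc.X : RatFunc ℚ) m) (_root_.qRatio ζ m) :=
  .prod fun i hi => (one_sub_X_pow ζ _).div (one_sub_X_pow ζ _) (h i (mem_range.1 hi))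

theorem perturbedRatio_eq_qRatio_pow_mul (hζ : IsPrimitiveRoot ζ (2 * N + 1)) {w : RatFunc ℚ}
    (hw : SpecializesTo ζ w 0) {k : ℕ} (hk : k ≤ N) :
    ∃ g, SpecializesTo ζ g (qLogDeriv ζ k) ∧
      perturbedRatio RatFunc.X w k = qRatio RatFunc.X k ^ 4 * (1 + w * g) := by
  set q : RatFunc ℚ := RatFunc.X
  have sq : SpecializesTo ζ q ζ := .X ζ
  have hP {i : ℕ} (hi : i ∈ range k) : 1 - ζ ^ (2 * i + 2) ≠ 0 :=
    one_sub_even_pow_ne_zero hζ (by have := mem_range.1 hi; omega)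
  have hQ {i : ℕ} (hi : i ∈ range k) : 1 - ζ ^ (2 * i + 1) ≠ 0 :=
    one_sub_odd_pow_ne_zero hζ ((mem_range.1 hi).trans_le hk)
  have sP {i : ℕ} (hi : i ∈ range k) :
      SpecializesTo ζ (q ^ (2 * i + 2) / (1 - q ^ (2 * i + 2)) ^ 3) _ :=
    (sq.pow _).div ((SpecializesTo.one_sub_X_pow ζ _).pow 3) (pow_ne_zero 3 (hP hi))
  have sQ {i : ℕ} (hi : i ∈ range k) :
      SpecializesTo ζ ((q ^ (2 * i + 1)) ^ 2 / (1 - q ^ (2 * i + 1)) ^ 3) _ :=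
    ((sq.pow _).pow 2).div ((SpecializesTo.one_sub_X_pow ζ _).pow 3) (pow_ne_zero 3 (hQ hi))
  have sd {i : ℕ} (hi : i ∈ range k) :
      SpecializesTo ζ (1 - w * (q ^ (2 * i + 2) / (1 - q ^ (2 * i + 2)) ^ 3)) 1 :=
    ((SpecializesTo.one ζ).sub (hw.mul (sP hi))).of_eq (by ring)
  obtain ⟨g, sg, prod_eq⟩ := SpecializesTo.prod_one_add_mul hw fun i hi =>
    (((sQ hi).add (sP hi)).div (sd hi) one_ne_zero).of_eq (div_one _)
  refine ⟨g, sg, ?_⟩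
  rw [← prod_eq, perturbedRatio, qRatio, ← prod_pow, ← prod_mul_distrib]
  exact prod_congr rfl fun i hi => perturbed_factor_eq
    ((SpecializesTo.one_sub_X_pow ζ _).ne_zero (hP hi))
    ((SpecializesTo.one_sub_X_pow ζ _).ne_zero (hQ hi)) ((sd hi).ne_zero one_ne_zero)

theorem truncatedSum_congr_sum_perturbedRatio (hζ : IsPrimitiveRoot ζ (2 * N + 1))
    {u v : RatFunc ℚ} (hu : SpecializesTo ζ u 0) (hv : SpecializesTo ζ v c) :
    RatFuncCongr (cyclotomic (2 * N + 1) ℚ ^ 4) ((1 - RatFunc.X) * truncatedSum N)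
      (∑ k ∈ range (N + 1),
        (1 - RatFunc.X ^ (4 * k + 1)) * perturbedRatio RatFunc.X (u ^ 3 * v) k) := by
  have sw : SpecializesTo ζ (u ^ 3 * v) 0 := ((hu.pow 3).mul hv).of_eq (by simp)
  choose! g sg perturbed_eq using fun k (hk : k ∈ range (N + 1)) =>
    perturbedRatio_eq_qRatio_pow_mul hζ sw (mem_range_succ_iff.1 hk)
  have sum_sg : SpecializesTo ζ (∑ k ∈ range (N + 1),
      (1 - RatFunc.X ^ (4 * k + 1)) * qRatio RatFunc.X k ^ 4 * g k) 0 :=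
    (SpecializesTo.sum fun k hk => ((SpecializesTo.one_sub_X_pow ζ _).mul
      ((SpecializesTo.qRatio fun i hi => one_sub_even_pow_ne_zero hζ
        (by have := mem_range.1 hk; omega)).pow 4)).mul (sg k hk)).of_eq
      (sum_qRatio_qLogDeriv_eq_zero hζ)
  refine .of_sub_eq_pow_mul (by omega) hζ hu ((hv.neg.mul sum_sg).of_eq (mul_zero _)) ?_
  rw [one_sub_X_mul_truncatedSum, ← sum_sub_distrib, mul_sum, mul_sum]
  refine sum_congr rfl fun k hk => ?_
  rw [perturbed_eq k hk]
  ring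

/-- The quadratic is a factor of the cubic `(1 - Z) ^ 3 - w * Z`, with `w = -(1 - y) ^ 3 / y ^ 2`;
this cubic tends to `(1 - Z) ^ 3` as `y` tends to `1`. -/
theorem SpecializesTo.wellPoisedQuadratic {y Z : RatFunc ℚ} (hy : SpecializesTo ζ y 1)
    (hZ : SpecializesTo ζ Z c) :
    SpecializesTo ζ (y - (3 - y⁻¹) * Z + Z ^ 2) ((1 - c) ^ 2) :=
  ((hy.sub (((natCast ζ 3).sub (hy.inv one_ne_zero)).mul hZ)).add (hZ.pow 2)).of_eq
    (by push_cast; ring)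

theorem prod_congr_congruenceRHS (hζ : IsPrimitiveRoot ζ (2 * N + 1)) {y : RatFunc ℚ}
    (hy : y = RatFunc.X ^ (2 * N + 1)) :
    RatFuncCongr (cyclotomic (2 * N + 1) ℚ ^ 4)
      ((1 - y) * (RatFunc.X ^ N)⁻¹ * ∏ i ∈ range N, (1 + (1 - y) ^ 2 * -(RatFunc.X ^ (2 * i + 2) /
        (y * (y - (3 - y⁻¹) * RatFunc.X ^ (2 * i + 2) + (RatFunc.X ^ (2 * i + 2)) ^ 2)))))
      ((1 - RatFunc.X) * congruenceRHS (2 * N + 1)) := by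
  have sX := SpecializesTo.X (K := ℚ) ζ
  have sy : SpecializesTo ζ y 1 := hy ▸ (sX.pow _).of_eq hζ.pow_eq_one
  have su : SpecializesTo ζ (1 - y) 0 := ((SpecializesTo.one ζ).sub sy).of_eq (sub_self 1)
  obtain ⟨g, sg, prod_eq⟩ := SpecializesTo.prod_one_add_mul
    ((su.pow 2).of_eq (by simp)) fun i (hi : i ∈ range N) =>
      ((sX.pow (2 * i + 2)).div (sy.mul (sy.wellPoisedQuadratic (sX.pow (2 * i + 2))))
        (mul_ne_zero one_ne_zero (pow_ne_zero 2 (one_sub_even_pow_ne_zero hζ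
          (by have := mem_range.1 hi; omega))))).neg
  simp only [one_mul] at sg
  rw [sum_neg_distrib, sum_even_div_one_sub_sq hζ] at sg
  have s24 : SpecializesTo ζ (24 : RatFunc ℚ) 24 := by simpa using SpecializesTo.natCast ζ 24
  have sn : SpecializesTo ζ ((((2 * N + 1 : ℕ) : RatFunc ℚ) ^ 2 - 1) / 24) _ :=
    (((SpecializesTo.natCast ζ _).pow 2).sub (.one ζ)).div s24 (by norm_num)
  rw [prod_eq, one_sub_X_mul_congruenceRHS, ← hy]
  exact .of_sub_eq_pow_mul (m := 3) (by omega) hζ su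
    ((((sX.pow N).inv (pow_ne_zero N (hζ.ne_zero (by omega)))).mul (sg.sub sn)).of_eq (by ring))
    (by ring)

theorem truncatedSum_congr_cyclotomic_pow_four (hN : 0 < N) (hζ : IsPrimitiveRoot ζ (2 * N + 1)) :
    RatFuncCongr (cyclotomic (2 * N + 1) ℚ ^ 4) (truncatedSum N) (congruenceRHS (2 * N + 1)) := by
  have sX := SpecializesTo.X (K := ℚ) ζ
  set y : RatFunc ℚ := RatFunc.X ^ (2 * N + 1) with hy
  have sy : SpecializesTo ζ y 1 := (sX.pow _).of_eq hζ.pow_eq_one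
  have su : SpecializesTo ζ (1 - y) 0 := ((SpecializesTo.one ζ).sub sy).of_eq (sub_self 1)
  have sv := ((sy.pow 2).inv (pow_ne_zero 2 one_ne_zero)).neg
  have rogers := sum_perturbedRatio RatFunc.X_ne_zero (fun m => one_sub_X_pow_ne_zero) hy
    fun i hi => (sy.wellPoisedQuadratic (sX.pow _)).ne_zero
      (pow_ne_zero 2 (one_sub_even_pow_ne_zero hζ (by omega)))
  rw [neg_div, div_eq_mul_inv, ← mul_neg] at rogers
  refine .of_mul_left (by omega) hζ ((SpecializesTo.one ζ).sub sX)
    (sub_ne_zero.2 (hζ.ne_one (by omega)).symm) ?_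
  have := truncatedSum_congr_sum_perturbedRatio hζ su sv
  rw [rogers] at this
  exact this.trans (prod_congr_congruenceRHS hζ hy)

end HighestCyclotomicFactor

section SecondHalf

theorem qRatio_eq_mul_of_lt {K : Type*} [Field K] (q : K) {N k : ℕ} (h : N < k) :
    qRatio q k = (1 - q ^ (2 * N + 1)) * ((∏ i ∈ (range k).erase N, (1 - q ^ (2 * i + 1))) /
      ∏ i ∈ range k, (1 - q ^ (2 * i + 2))) := by
  rw [qRatio, prod_div_distrib, ← mul_prod_erase _ _ (mem_range.2 h), mul_div_assoc]

variable {L : Type} [Field L] [CharZero L] {ζ : L} {N : ℕ}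

theorem truncatedSum_two_mul_congr (hN : 0 < N) (hζ : IsPrimitiveRoot ζ (2 * N + 1)) :
    RatFuncCongr (cyclotomic (2 * N + 1) ℚ ^ 4) (truncatedSum (2 * N)) (truncatedSum N) := by
  have sX := SpecializesTo.X (K := ℚ) ζ
  have sy : SpecializesTo ζ (1 - RatFunc.X ^ (2 * N + 1) : RatFunc ℚ) 0 :=
    (SpecializesTo.one_sub_X_pow ζ _).of_eq (by rw [hζ.pow_eq_one, sub_self])
  have quotient_regular {j : ℕ} (hj : j ∈ range N) : SpecializesTo ζ
      ((∏ i ∈ (range (N + 1 + j)).erase N, (1 - RatFunc.X ^ (2 * i + 1) : RatFunc ℚ)) /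
        ∏ i ∈ range (N + 1 + j), (1 - RatFunc.X ^ (2 * i + 2))) _ :=
    (SpecializesTo.prod fun i _ => .one_sub_X_pow ζ _).div
      (.prod fun i _ => .one_sub_X_pow ζ _)
      (prod_ne_zero_iff.2 fun i hi => one_sub_even_pow_ne_zero hζ
        (by have := mem_range.1 hi; have := mem_range.1 hj; omega))
  refine .of_mul_left (by omega) hζ ((SpecializesTo.one ζ).sub sX)
    (sub_ne_zero.2 (hζ.ne_one (by omega)).symm) ?_
  refine .of_sub_eq_pow_mul (m := 3) (by omega) hζ sy
    ((sy.mul (.sum fun j hj => (SpecializesTo.one_sub_X_pow ζ (4 * (N + 1 + j) + 1)).mul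
      ((quotient_regular hj).pow 4))).of_eq (zero_mul _)) ?_
  rw [one_sub_X_mul_truncatedSum, one_sub_X_mul_truncatedSum, show 2 * N + 1 = N + 1 + N by ring,
    sum_range_add, add_sub_cancel_left, ← mul_assoc, ← pow_succ, mul_sum]
  refine sum_congr rfl fun j _ => ?_
  rw [qRatio_eq_mul_of_lt _ (show N < N + 1 + j by omega), show N + 1 + N = 2 * N + 1 by ring]
  ring

end SecondHalf

section ProperDivisors

theorem qRatio_add {K : Type*} [Field K] (q : K) (m j : ℕ) :
    qRatio q (m + j) = qRatio q m *
      ∏ i ∈ range j, (1 - q ^ (2 * (m + i) + 1)) / (1 - q ^ (2 * (m + i) + 2)) :=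
  prod_range_add _ _ _

/-- Among the `2 * D + 1` new factors of the numerator and of the denominator, exactly one of each
is divisible by `1 - q ^ (2 * D + 1)`, and these two divisors cancel. -/
theorem qRatio_mul_succ {K : Type*} [Field K] {q : K} {D : ℕ} (hq : 1 - q ^ (2 * D + 1) ≠ 0)
    (l : ℕ) :
    qRatio q ((2 * D + 1) * (l + 1)) = qRatio q ((2 * D + 1) * l) *
      ((∏ i ∈ (range (2 * D + 1)).erase D, (1 - q ^ (2 * ((2 * D + 1) * l + i) + 1))) *
        (qInteger (q ^ (2 * D + 1)) (2 * l + 1) / qInteger (q ^ (2 * D + 1)) (2 * l + 2)) /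
        ∏ i ∈ range (2 * D), (1 - q ^ (2 * ((2 * D + 1) * l + i) + 2))) := by
  have numerator : 1 - q ^ (2 * ((2 * D + 1) * l + D) + 1) =
      (1 - q ^ (2 * D + 1)) * qInteger (q ^ (2 * D + 1)) (2 * l + 1) := by
    rw [one_sub_mul_qInteger, ← pow_mul]
    congr 2
    ring
  have denominator : 1 - q ^ (2 * ((2 * D + 1) * l + 2 * D) + 2) =
      (1 - q ^ (2 * D + 1)) * qInteger (q ^ (2 * D + 1)) (2 * l + 2) := by
    rw [one_sub_mul_qInteger, ← pow_mul]
    congr 2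
    ring
  rw [mul_add_one, qRatio_add, prod_div_distrib,
    ← mul_prod_erase (range (2 * D + 1)) _ (mem_range.2 (by omega : D < 2 * D + 1)),
    prod_range_succ (fun i => 1 - q ^ (2 * ((2 * D + 1) * l + i) + 2)), numerator, denominator,
    mul_assoc (1 - _), mul_left_comm _ (1 - q ^ (2 * D + 1)), mul_div_mul_left _ _ hq]
  ring

theorem one_sub_pow_block {R : Type*} [Ring R] {ζ : R} {D : ℕ} (hζ : ζ ^ (2 * D + 1) = 1)
    (e l i b : ℕ) :
    1 - ζ ^ (e * ((2 * D + 1) * l + i) + b) = 1 - ζ ^ (e * i + b) := by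
  rw [show e * ((2 * D + 1) * l + i) + b = (2 * D + 1) * (e * l) + (e * i + b) by ring, pow_add,
    pow_mul, hζ, one_pow, one_mul]

variable {L : Type} [Field L] [CharZero L] {ζ : L} {D : ℕ}

theorem specializesTo_qRatio_block (hζ : IsPrimitiveRoot ζ (2 * D + 1)) (l : ℕ) :
    ∃ c, SpecializesTo ζ (qRatio (RatFunc.X : RatFunc ℚ) ((2 * D + 1) * l)) c := by
  induction l with
  | zero => exact ⟨1, by simpa [qRatio] using SpecializesTo.one ζ⟩
  | succ l ih =>
    obtain ⟨c, sc⟩ := ih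
    have sI (m : ℕ) : SpecializesTo ζ (qInteger ((RatFunc.X : RatFunc ℚ) ^ (2 * D + 1)) m) m :=
      (SpecializesTo.sum fun i _ => ((SpecializesTo.X ζ).pow _).pow i).of_eq
        (by simp [hζ.pow_eq_one])
    rw [qRatio_mul_succ (one_sub_X_pow_ne_zero (by omega))]
    refine ⟨_, sc.mul (.div (.mul (.prod fun i _ => .one_sub_X_pow ζ _)
      ((sI _).div (sI _) (Nat.cast_ne_zero.2 (Nat.succ_ne_zero _))))
      (.prod fun i _ => .one_sub_X_pow ζ _) (prod_ne_zero_iff.2 fun i hi => ?_))⟩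
    rw [one_sub_pow_block hζ.pow_eq_one]
    exact one_sub_even_pow_ne_zero hζ (mem_range.1 hi)

theorem specializesTo_qRatio_block_add (hζ : IsPrimitiveRoot ζ (2 * D + 1)) {l : ℕ} {c : L}
    (hc : SpecializesTo ζ (qRatio (RatFunc.X : RatFunc ℚ) ((2 * D + 1) * l)) c) {j : ℕ}
    (hj : j ≤ 2 * D) :
    SpecializesTo ζ (qRatio (RatFunc.X : RatFunc ℚ) ((2 * D + 1) * l + j)) (c * qRatio ζ j) := by
  rw [qRatio_add]
  refine hc.mul (.prod fun i hi => ?_)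
  have hP : 1 - ζ ^ (2 * i + 2) ≠ 0 :=
    one_sub_even_pow_ne_zero hζ ((mem_range.1 hi).trans_le hj)
  rw [← one_sub_pow_block hζ.pow_eq_one 2 l i 1]
  rw [← one_sub_pow_block hζ.pow_eq_one 2 l i 2] at hP ⊢
  exact (SpecializesTo.one_sub_X_pow ζ _).div (.one_sub_X_pow ζ _) hP

theorem specializesTo_sum_block (hζ : IsPrimitiveRoot ζ (2 * D + 1)) (l : ℕ) {J : ℕ}
    (hJ : J ≤ 2 * D + 1) (sum_eq_zero : ∑ j ∈ range J, (1 - ζ ^ (4 * j + 1)) * qRatio ζ j ^ 4 = 0) :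
    SpecializesTo ζ (∑ j ∈ range J, (1 - RatFunc.X ^ (4 * ((2 * D + 1) * l + j) + 1)) *
      qRatio (RatFunc.X : RatFunc ℚ) ((2 * D + 1) * l + j) ^ 4) 0 := by
  obtain ⟨c, sc⟩ := specializesTo_qRatio_block hζ l
  refine (SpecializesTo.sum fun j hj => (SpecializesTo.one_sub_X_pow ζ _).mul
    ((specializesTo_qRatio_block_add hζ sc
      (by have := mem_range.1 hj; omega)).pow 4)).of_eq ?_
  rw [← mul_zero (c ^ 4), ← sum_eq_zero, mul_sum]
  refine sum_congr rfl fun j _ => ?_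
  rw [one_sub_pow_block hζ.pow_eq_one]
  ring

theorem sum_qRatio_full_eq_zero (hζ : IsPrimitiveRoot ζ (2 * D + 1)) :
    ∑ j ∈ range (2 * D + 1), (1 - ζ ^ (4 * j + 1)) * qRatio ζ j ^ 4 = 0 := by
  rw [show 2 * D + 1 = D + 1 + D by ring, sum_range_add, sum_qRatio_eq_zero hζ, zero_add]
  refine sum_eq_zero fun j _ => ?_
  rw [qRatio_eq_mul_of_lt ζ (show D < D + 1 + j by omega), hζ.pow_eq_one]
  ring

theorem specializesTo_sum_full (hζ : IsPrimitiveRoot ζ (2 * D + 1)) (e : ℕ) :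
    SpecializesTo ζ (∑ k ∈ range ((2 * D + 1) * e),
      (1 - RatFunc.X ^ (4 * k + 1)) * qRatio (RatFunc.X : RatFunc ℚ) k ^ 4) 0 := by
  induction e with
  | zero => simpa using SpecializesTo.zero ζ
  | succ e ih =>
    rw [mul_add_one, sum_range_add]
    exact (ih.add (specializesTo_sum_block hζ e le_rfl (sum_qRatio_full_eq_zero hζ))).of_eq
      (add_zero 0)

theorem specializesTo_sum_half (hζ : IsPrimitiveRoot ζ (2 * D + 1)) (e : ℕ) :
    SpecializesTo ζ (∑ k ∈ range ((2 * D + 1) * e + (D + 1)),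
      (1 - RatFunc.X ^ (4 * k + 1)) * qRatio (RatFunc.X : RatFunc ℚ) k ^ 4) 0 := by
  rw [sum_range_add]
  exact ((specializesTo_sum_full hζ e).add
    (specializesTo_sum_block hζ e (by omega) (sum_qRatio_eq_zero hζ))).of_eq (add_zero 0)

theorem specializesTo_one_sub_X_mul_congruenceRHS (hζ : IsPrimitiveRoot ζ (2 * D + 1)) {N : ℕ}
    (hDN : 2 * D + 1 ∣ 2 * N + 1) :
    SpecializesTo ζ ((1 - RatFunc.X) * congruenceRHS (2 * N + 1)) 0 := by
  have sy : SpecializesTo ζ (1 - RatFunc.X ^ (2 * N + 1) : RatFunc ℚ) 0 :=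
    (SpecializesTo.one_sub_X_pow ζ _).of_eq (by rw [(hζ.pow_eq_one_iff_dvd _).2 hDN, sub_self])
  have s24 : SpecializesTo ζ (24 : RatFunc ℚ) 24 := by simpa using SpecializesTo.natCast ζ 24
  rw [one_sub_X_mul_congruenceRHS]
  exact ((((SpecializesTo.X ζ).pow N).inv (pow_ne_zero _ (hζ.ne_zero (by omega)))).mul
    (sy.add (((((SpecializesTo.natCast ζ (2 * N + 1)).pow 2).sub (.one ζ)).div s24
      (by norm_num)).mul (sy.pow 3)))).of_eq (by ring)

theorem truncatedSum_congr_cyclotomic (hD : 0 < D) (hζ : IsPrimitiveRoot ζ (2 * D + 1))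
    {N M : ℕ} (hDN : 2 * D + 1 ∣ 2 * N + 1) (hM : SpecializesTo ζ
      (∑ k ∈ range (M + 1), (1 - RatFunc.X ^ (4 * k + 1)) * qRatio (RatFunc.X : RatFunc ℚ) k ^ 4)
      0) :
    RatFuncCongr (cyclotomic (2 * D + 1) ℚ) (truncatedSum M) (congruenceRHS (2 * N + 1)) := by
  rw [← one_sub_X_mul_truncatedSum] at hM
  rw [← pow_one (cyclotomic _ _)]
  refine .of_mul_left (by omega) hζ ((SpecializesTo.one ζ).sub (.X ζ))
    (sub_ne_zero.2 (hζ.ne_one (by omega)).symm) ?_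
  exact .of_sub_eq_pow_mul (m := 0) (by omega) hζ (.zero ζ)
    ((hM.sub (specializesTo_one_sub_X_mul_congruenceRHS hζ hDN)).of_eq (sub_zero 0))
    (by rw [pow_zero, one_mul])

end ProperDivisors

section Combination

theorem exists_eq_mul_of_dvd_two_mul_add_one {d N : ℕ} (hd : d ∣ 2 * N + 1) (hd1 : d ≠ 1) :
    ∃ D e, 0 < D ∧ d = 2 * D + 1 ∧ 2 * N + 1 = (2 * D + 1) * (2 * e + 1) := by
  obtain ⟨c, hc⟩ := hd
  obtain ⟨⟨D, rfl⟩, e, rfl⟩ := Nat.odd_mul.1 (hc ▸ odd_two_mul_add_one N : Odd (d * c))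
  exact ⟨D, e, by omega, rfl, hc⟩

theorem truncatedSum_congr_cyclotomic_of_dvd {d N : ℕ} (hd : d ∣ 2 * N + 1) (hd1 : d ≠ 1) :
    RatFuncCongr (cyclotomic d ℚ) (truncatedSum N) (congruenceRHS (2 * N + 1)) ∧
      RatFuncCongr (cyclotomic d ℚ) (truncatedSum (2 * N)) (congruenceRHS (2 * N + 1)) := by
  obtain ⟨D, e, hD, rfl, eq_mul⟩ := exists_eq_mul_of_dvd_two_mul_add_one hd hd1
  have hζ := Complex.isPrimitiveRoot_exp (2 * D + 1) (by omega)
  have half_eq : N + 1 = (2 * D + 1) * e + (D + 1) := by linarith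
  exact ⟨truncatedSum_congr_cyclotomic hD hζ hd (half_eq ▸ specializesTo_sum_half hζ e),
    truncatedSum_congr_cyclotomic hD hζ hd (eq_mul ▸ specializesTo_sum_full hζ (2 * e + 1))⟩

theorem qInteger_mul_cyclotomic_pow_dvd {n : ℕ} (hn : 1 < n) {P : ℚ[X]}
    (h4 : cyclotomic n ℚ ^ 4 ∣ P) (h : ∀ d, d ∣ n → d ≠ 1 → cyclotomic d ℚ ∣ P) :
    qInteger (X : ℚ[X]) n * cyclotomic n ℚ ^ 3 ∣ P := by
  have n_mem : n ∈ n.divisors.erase 1 :=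
    mem_erase.2 ⟨hn.ne', Nat.mem_divisors_self n (by omega)⟩
  rw [qInteger, ← prod_cyclotomic_eq_geom_sum (by omega) ℚ, ← mul_prod_erase _ _ n_mem,
    mul_right_comm, ← pow_succ']
  refine IsCoprime.mul_dvd (.prod_right fun d hd => .pow_left ?_) h4
    (prod_dvd_of_coprime (fun a _ b _ hab => cyclotomic.isCoprime_rat hab) fun d hd => ?_)
  · exact cyclotomic.isCoprime_rat (ne_of_mem_erase hd).symm
  · have hd' := mem_of_mem_erase hd
    exact h d (Nat.dvd_of_mem_divisors (mem_of_mem_erase hd')) (ne_of_mem_erase hd')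

theorem truncatedSum_zero : truncatedSum 0 = congruenceRHS 1 := by
  simp [truncatedSum, congruenceRHS, qShiftedFactorial, qInteger]

end Combination

theorem mainTheorem6 (n : ℕ) (hn : Odd n) :
    RatFuncCongr (qInteger (X : ℚ[X]) n * cyclotomic n ℚ ^ 3)
        (truncatedSum ((n - 1) / 2)) (congruenceRHS n) ∧
      RatFuncCongr (qInteger (X : ℚ[X]) n * cyclotomic n ℚ ^ 3)
        (truncatedSum (n - 1)) (congruenceRHS n) := by
  obtain ⟨N, rfl⟩ := hn
  rw [Nat.add_sub_cancel, Nat.mul_div_cancel_left N two_pos]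
  rcases Nat.eq_zero_or_pos N with rfl | hN
  · simp [RatFuncCongr, truncatedSum_zero]
  have hζ := Complex.isPrimitiveRoot_exp (2 * N + 1) (by omega)
  have half_congr := truncatedSum_congr_cyclotomic_pow_four hN hζ
  exact ⟨qInteger_mul_cyclotomic_pow_dvd (by omega) half_congr
      fun _ hd hd1 => (truncatedSum_congr_cyclotomic_of_dvd hd hd1).1,
    qInteger_mul_cyclotomic_pow_dvd (by omega) ((truncatedSum_two_mul_congr hN hζ).trans half_congr)
      fun _ hd hd1 => (truncatedSum_congr_cyclotomic_of_dvd hd hd1).2⟩
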